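/- Let $d\ge 1$ and let $\Omega\subset\mathbb R^d$ be a nonempty bounded open set (for example a smooth bounded domain). For $s\ge 0$ write $m=\lfloor s\rfloor$, $\sigma=s-m$, and let $H^s(\Omega)$ be the space of real functions $u\in L^2(\Omega)$ whose weak derivatives of order at most $m$ lie in $L^2(\Omega)$ and for which the norm $$\|u\|_s=\Big(\sum_{k\le m}\ \sum_{i_1,\dots,i_k=1}^d\|\partial_{i_1}\cdots\partial_{i_k}u\|_{L^2(\Omega)}^2+\sum_{i_1,\dots,i_m=1}^d\int_\Omega\int_\Omega\frac{|\partial_{i_1}\cdots\partial_{i_m}u(x)-\partial_{i_1}\cdots\partial_{i_m}u(y)|^2}{|x-y|^{d+2\sigma}}\,dx\,dy\Big)^{1/2}$$ is finite, where the last sum is omitted if $\sigma=0$. Let $H^s_0(\Omega)$ be the closure of $C_c^\infty(\Omega)$ in $H^s(\Omega)$ and $\mathcal F(s,R)=\{f\in H^s_0(\Omega):\|f\|_s\le R\}$. Let $K\in C_c^\infty(\mathbb R^d)$ be real-valued with $\int_{\mathbb R^d}K(x)\,dx=1$, and let $s_r\ge 1$ be an integer such that $\int_{\mathbb R^d}x_1^{r_1}\cdots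 x_d^{r_d}K(x)\,dx=0$ for all $r\in\mathbb N^d$ with $1\le|r|\le s_r-1$, while $\int_{\mathbb R^d}x_1^{r_1}\cdots x_d^{r_d}K(x)\,dx\ne 0$ for at least one $r\in\mathbb N^d$ with $|r|=s_r$. For $\beta>0$ put $K_\beta=\beta^{-d}K(\beta^{-1}\,\cdot)$ and $(K_\beta*f)(x)=\int_\Omega K_\beta(x-y)f(y)\,dy$. Then for every real $s\ge s_r$ and every $R>0$, $$\sup_{f\in\mathcal F(s,R)}\|K_\beta*f-f\|_{L^2(\Omega)}\sim\beta^{s_r}$$ in the following sense: there is a constant $C>0$, independent of $\beta$, such that $$\sup_{f\in\mathcal F(s,R)}\|K_\beta*f-f\|_{L^2(\Omega)}\le C\,\beta^{s_r}\qquad\text{for all }\beta>0,$$ and for every $\beta_0>0$ there is a constant $c>0$, independent of $\beta$, such that $$\sup_{f\in\mathcal F(s,R)}\|K_\beta*f-f\|_{L^2(\Omega)}\ge c\,\beta^{s_r}\qquad\text{for all }0<\beta\le\beta_0.$$ -/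

import Mathlib

open MeasureTheory Set TopologicalSpace
open scoped ENNReal ContDiff Distributions

noncomputable section

namespace SobolevReg

/-- `ℝ^d` with its Euclidean norm. -/
abbrev Euc (d : ℕ) : Type := EuclideanSpace ℝ (Fin d)

/-- The iterated partial derivative `∂_{I 0} ⋯ ∂_{I (k-1)} φ` of a smooth function `φ`. -/
def partialDeriv {d k : ℕ} (I : Fin k → Fin d) (φ : Euc d → ℝ) (x : Euc d) : ℝ :=
  iteratedFDeriv ℝ k φ x (fun j => EuclideanSpace.single (I j) (1 : ℝ))

/-- `v` is the weak (distributional) derivative `∂_{I 0} ⋯ ∂_{I (k-1)} u` on the open set `Ω`;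
`𝓓(Ω, ℝ)` is the space `C_c^∞(Ω)`. -/
def HasWeakDeriv {d k : ℕ} (Ω : Opens (Euc d)) (I : Fin k → Fin d) (u v : Euc d → ℝ) : Prop :=
  LocallyIntegrableOn u (Ω : Set (Euc d)) ∧ LocallyIntegrableOn v (Ω : Set (Euc d)) ∧
    ∀ φ : 𝓓(Ω, ℝ),
      ∫ x in (Ω : Set (Euc d)), u x * partialDeriv I φ x =
        (-1) ^ k * ∫ x in (Ω : Set (Euc d)), v x * φ x

open Classical in
/-- A representative of the weak derivative of `u` on `Ω` (unique up to null sets) if there is one,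
and `0` otherwise. -/
def weakDeriv {d k : ℕ} (Ω : Opens (Euc d)) (I : Fin k → Fin d) (u : Euc d → ℝ) : Euc d → ℝ :=
  if h : ∃ v, HasWeakDeriv Ω I u v then h.choose else 0

/-- The squared Gagliardo seminorm
`∫_Ω ∫_Ω |v x - v y|² / |x - y|^(d + 2 σ) dx dy` of order `σ ∈ (0, 1)`. -/
def gagliardoSq {d : ℕ} (Ω : Opens (Euc d)) (σ : ℝ) (v : Euc d → ℝ) : ℝ≥0∞ :=
  ∫⁻ x in (Ω : Set (Euc d)), ∫⁻ y in (Ω : Set (Euc d)),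
    ENNReal.ofReal ((v x - v y) ^ 2 / ‖x - y‖ ^ ((d : ℝ) + 2 * σ))

/-- The fractional part of the squared `H^s(Ω)` norm: with `m = ⌊s⌋` and `σ = s - m`, the sum of the
squared Gagliardo seminorms of order `σ` of the weak derivatives of order `m`; it is absent when `s`
is an integer. -/
def fracPartSq {d : ℕ} (Ω : Opens (Euc d)) (s : ℝ) (u : Euc d → ℝ) : ℝ≥0∞ :=
  if Int.fract s = 0 then 0
  else ∑ I : Fin ⌊s⌋₊ → Fin d, gagliardoSq Ω (Int.fract s) (weakDeriv Ω I u)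

/-- The norm of `H^s(Ω)`, `s ≥ 0`, of a function that satisfies `MemSobolev Ω s`: the square root of
`∑_{k ≤ ⌊s⌋} ‖D^k u‖²_{L²(Ω)}` plus the fractional part. Here `‖D^k u‖²` is the sum of the squares
of all the `∂_{I 0} ⋯ ∂_{I (k-1)} u`, so that a mixed derivative `∂^α u` is counted `k! / α!`
times. -/
def sobolevNorm {d : ℕ} (Ω : Opens (Euc d)) (s : ℝ) (u : Euc d → ℝ) : ℝ≥0∞ :=
  ((∑ k ∈ Finset.range (⌊s⌋₊ + 1), ∑ I : Fin k → Fin d,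
      eLpNorm (weakDeriv Ω I u) 2 (volume.restrict (Ω : Set (Euc d))) ^ 2)
    + fracPartSq Ω s u) ^ (1 / 2 : ℝ)

/-- `u ∈ H^s(Ω)`, for `s ≥ 0`: the weak derivatives of all orders `k ≤ ⌊s⌋` (including `u` itself)
exist and lie in `L²(Ω)`, and the fractional part of the norm is finite. -/
def MemSobolev {d : ℕ} (Ω : Opens (Euc d)) (s : ℝ) (u : Euc d → ℝ) : Prop :=
  (∀ k ≤ ⌊s⌋₊, ∀ I : Fin k → Fin d,
    ∃ v, HasWeakDeriv Ω I u v ∧ MemLp v 2 (volume.restrict (Ω : Set (Euc d)))) ∧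
  fracPartSq Ω s u < ⊤

/-- `u ∈ H^s_0(Ω)`, the closure of `C_c^∞(Ω)` in `H^s(Ω)`. -/
def MemSobolevZero {d : ℕ} (Ω : Opens (Euc d)) (s : ℝ) (u : Euc d → ℝ) : Prop :=
  MemSobolev Ω s u ∧
    ∀ ε : ℝ≥0∞, 0 < ε → ∃ φ : 𝓓(Ω, ℝ), sobolevNorm Ω s (fun x => u x - φ x) < ε

/-- The Sobolev ball `F(s, R) = {f ∈ H^s_0(Ω) : ‖f‖_s ≤ R}`. -/
def sobolevBall {d : ℕ} (Ω : Opens (Euc d)) (s R : ℝ) : Set (Euc d → ℝ) :=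
  {f | MemSobolevZero Ω s f ∧ sobolevNorm Ω s f ≤ ENNReal.ofReal R}

/-- The moment `∫ x_1^{r_1} ⋯ x_d^{r_d} K(x) dx`. -/
def moment {d : ℕ} (K : Euc d → ℝ) (r : Fin d → ℕ) : ℝ :=
  ∫ x : Euc d, (∏ i, x i ^ r i) * K x

/-- `K_β = β^{-d} K(β^{-1} ·)`. -/
def scaledKernel {d : ℕ} (K : Euc d → ℝ) (β : ℝ) (x : Euc d) : ℝ :=
  (β ^ d)⁻¹ * K (β⁻¹ • x)

/-- `(K_β * f)(x) = ∫_Ω K_β(x - y) f(y) dy`. -/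
def regularise {d : ℕ} (Ω : Opens (Euc d)) (K : Euc d → ℝ) (β : ℝ) (f : Euc d → ℝ)
    (x : Euc d) : ℝ :=
  ∫ y in (Ω : Set (Euc d)), scaledKernel K β (x - y) * f y

/-- `sup_{f ∈ F(s, R)} ‖K_β * f - f‖_{L²(Ω)}`. -/
def worstError {d : ℕ} (Ω : Opens (Euc d)) (K : Euc d → ℝ) (s R β : ℝ) : ℝ≥0∞ :=
  ⨆ f ∈ sobolevBall Ω s R,
    eLpNorm (fun x => regularise Ω K β f x - f x) 2 (volume.restrict (Ω : Set (Euc d)))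

end SobolevReg

end

/-! Write `n + 1` for the order `s_r`. Upper bound: after substituting `y = x - β w`, the error at a
test function `φ` is `∫ K w (φ (x - β w) - φ x) dw`, because `K` has integral 1. Taylor expansion in
`β w` produces terms of orders `1, …, n` that are combinations of vanishing moments. What remains is
at most `β ^ (n + 1)` times an average of translates of the derivatives of order `n + 1`, and
averaging translates does not increase the L² norm (`eLpNorm_regularise_sub_le`). Since `s ≥ s_r`,
those derivatives are controlled by the `H^s` norm. Density of test functions extends the bound to
the ball: for fixed `β` the convolution is bounded on L², and its constant, though bad in `β`, only
multiplies an approximation error that tends to 0 (`eLpNorm_regularise_sub_le_of_mem_sobolevBall`).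

Lower bound: any fixed test function, suitably scaled, lies in the ball, so one good function per
regime suffices. For small `β` take one that agrees near a point with a monomial whose moment of
order `n + 1` is nonzero; there the error is exactly `(-β) ^ (n + 1)` times that moment
(`exists_lower_bound_small`). For `β` between a positive threshold and `β₀` a constant bound is
enough: the convolution is bounded from L¹ to L² uniformly in such `β`, so a function with small L¹
norm relative to its L² norm loses most of its mass under it (`exists_lower_bound_large`). -/

namespace SobolevReg

/-! ### Classical iterated partial derivatives -/

section PartialDeriv

variable {d k : ℕ}

theorem partialDeriv_zero (I : Fin 0 → Fin d) (φ : Euc d → ℝ) : partialDeriv I φ = φ := by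
  ext x
  simp [partialDeriv]

theorem contDiff_partialDeriv (I : Fin k → Fin d) {φ : Euc d → ℝ} (hφ : ContDiff ℝ ∞ φ) :
    ContDiff ℝ ∞ (partialDeriv I φ) := by
  have h : ContDiff ℝ ∞ (iteratedFDeriv ℝ k φ) :=
    hφ.iteratedFDeriv_right (by exact_mod_cast le_top)
  exact (ContinuousMultilinearMap.apply ℝ (fun _ : Fin k => Euc d) ℝ
    (fun j => EuclideanSpace.single (I j) (1 : ℝ))).contDiff.comp h

theorem partialDeriv_succ (I : Fin (k + 1) → Fin d) {φ : Euc d → ℝ} (hφ : ContDiff ℝ ∞ φ) :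
    partialDeriv I φ = fun x =>
      fderiv ℝ (partialDeriv (Fin.tail I) φ) x (EuclideanSpace.single (I 0) 1) := by
  ext x
  have h : DifferentiableAt ℝ (iteratedFDeriv ℝ k φ) x :=
    hφ.contDiffAt.differentiableAt_iteratedFDeriv (by exact_mod_cast WithTop.coe_lt_top _)
  exact h.iteratedFDeriv_succ_apply_left'

theorem tsupport_partialDeriv_subset (I : Fin k → Fin d) (φ : Euc d → ℝ) :
    tsupport (partialDeriv I φ) ⊆ tsupport φ := by
  refine closure_minimal ?_ (isClosed_tsupport _)
  intro x hx
  refine support_iteratedFDeriv_subset (𝕜 := ℝ) k ?_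
  intro h
  apply hx
  simp [partialDeriv, h]

theorem hasCompactSupport_partialDeriv (I : Fin k → Fin d) {φ : Euc d → ℝ}
    (hφ : HasCompactSupport φ) : HasCompactSupport (partialDeriv I φ) :=
  hφ.of_isClosed_subset (isClosed_tsupport _) (tsupport_partialDeriv_subset I φ)

theorem partialDeriv_const_mul (I : Fin k → Fin d) {φ : Euc d → ℝ} (hφ : ContDiff ℝ ∞ φ) (c : ℝ)
    (x : Euc d) : partialDeriv I (fun y => c * φ y) x = c * partialDeriv I φ x := by
  have h : ContDiffAt ℝ k φ x := (hφ.of_le (by exact_mod_cast le_top)).contDiffAt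
  have := iteratedFDeriv_const_smul_apply' (a := c) h
  simp only [smul_eq_mul] at this
  simp [partialDeriv, this]

theorem contDiff_fderiv_apply {φ : Euc d → ℝ} (hφ : ContDiff ℝ ∞ φ) (v : Euc d) :
    ContDiff ℝ ∞ (fun x => fderiv ℝ φ x v) :=
  (hφ.fderiv_right (by exact_mod_cast le_top)).clm_apply contDiff_const

theorem fderiv_fderiv_apply_comm {φ : Euc d → ℝ} (hφ : ContDiff ℝ ∞ φ) (v w x : Euc d) :
    fderiv ℝ (fun y => fderiv ℝ φ y v) x w = fderiv ℝ (fun y => fderiv ℝ φ y w) x v := by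
  have h : DifferentiableAt ℝ (fderiv ℝ φ) x :=
    ((hφ.fderiv_right (m := ∞) (by exact_mod_cast le_top)).differentiable (by simp)).differentiableAt
  rw [fderiv_clm_apply h (by fun_prop), fderiv_clm_apply h (by fun_prop)]
  have hs : IsSymmSndFDerivAt ℝ φ x :=
    hφ.contDiffAt.isSymmSndFDerivAt (by
      rw [minSmoothness_of_isRCLikeNormedField]
      exact WithTop.coe_le_coe.2 (le_top : (2 : ℕ∞) ≤ ⊤))
  simpa using hs w v

/-- Symmetry of second derivatives, iterated. It is needed because integration by parts strips the
outermost derivative from one factor and puts it innermost on the other. -/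
theorem partialDeriv_fderiv_apply (I : Fin k → Fin d) {φ : Euc d → ℝ} (hφ : ContDiff ℝ ∞ φ)
    (v : Euc d) :
    partialDeriv I (fun x => fderiv ℝ φ x v) = fun x => fderiv ℝ (partialDeriv I φ) x v := by
  induction k with
  | zero => simp only [partialDeriv_zero]
  | succ k ih =>
    rw [partialDeriv_succ I (contDiff_fderiv_apply hφ v), ih, partialDeriv_succ I hφ]
    ext x
    exact fderiv_fderiv_apply_comm (contDiff_partialDeriv _ hφ) _ _ _

theorem integral_mul_partialDeriv (I : Fin k → Fin d) {u φ : Euc d → ℝ} (hu : ContDiff ℝ ∞ u)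
    (hφ : ContDiff ℝ ∞ φ) (hc : HasCompactSupport φ) :
    ∫ x, u x * partialDeriv I φ x = (-1) ^ k * ∫ x, partialDeriv I u x * φ x := by
  induction k generalizing u with
  | zero => simp [partialDeriv_zero]
  | succ k ih =>
    have hψ := contDiff_partialDeriv (Fin.tail I) hφ
    have hψc := hasCompactSupport_partialDeriv (Fin.tail I) hc
    have hu' := contDiff_fderiv_apply hu (EuclideanSpace.single (I 0) (1 : ℝ))
    have hψ' := contDiff_fderiv_apply hψ (EuclideanSpace.single (I 0) (1 : ℝ))
    rw [partialDeriv_succ I hφ, integral_mul_fderiv_eq_neg_fderiv_mul_of_integrable,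
      ih (Fin.tail I) hu', partialDeriv_fderiv_apply _ hu, partialDeriv_succ I hu]
    · ring
    · exact (hu'.continuous.mul hψ.continuous).integrable_of_hasCompactSupport hψc.mul_left
    · exact (hu.continuous.mul hψ'.continuous).integrable_of_hasCompactSupport
        (hψc.fderiv_apply ℝ _).mul_left
    · exact (hu.continuous.mul hψ.continuous).integrable_of_hasCompactSupport hψc.mul_left
    · exact fun x _ => (hu.differentiable (by simp)).differentiableAt
    · exact fun x _ => (hψ.differentiable (by simp)).differentiableAt

/-- Multilinear expansion of `w` in the standard basis. It links Taylor terms both to moments of the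
kernel and to the derivatives counted in the Sobolev norm. -/
theorem iteratedFDeriv_apply_const_eq_sum (k : ℕ) (φ : Euc d → ℝ) (x w : Euc d) :
    iteratedFDeriv ℝ k φ x (fun _ => w) =
      ∑ I : Fin k → Fin d, (∏ j, w (I j)) * partialDeriv I φ x := by
  have hw : w = ∑ i, w i • EuclideanSpace.single i (1 : ℝ) := by
    ext j
    simp [Finset.sum_apply, Pi.single_apply]
  conv_lhs => rw [hw]
  rw [ContinuousMultilinearMap.map_sum]
  refine Finset.sum_congr rfl fun I _ => ?_
  rw [ContinuousMultilinearMap.map_smul_univ, smul_eq_mul, partialDeriv]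

end PartialDeriv

/-! ### Weak derivatives and their uniqueness -/

section WeakDeriv

variable {d k : ℕ} {Ω : Opens (Euc d)}

theorem integrable_mul_of_tsupport_subset {v g : Euc d → ℝ}
    (hv : LocallyIntegrableOn v (Ω : Set (Euc d))) (hg : Continuous g) (hc : HasCompactSupport g)
    (hs : tsupport g ⊆ Ω) : Integrable (fun x => v x * g x) := by
  have h : IntegrableOn (fun x => v x * g x) (tsupport g) :=
    (hv.integrableOn_compact_subset hs hc).mul_continuousOn hg.continuousOn hc
  refine (integrableOn_iff_integrable_of_support_subset ?_).1 h
  intro x hx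
  exact subset_tsupport g (fun h0 => hx (by simp [h0]))

theorem setIntegral_mul_eq_integral {u g : Euc d → ℝ} (hs : tsupport g ⊆ Ω) :
    ∫ x in (Ω : Set (Euc d)), u x * g x = ∫ x, u x * g x := by
  refine setIntegral_eq_integral_of_forall_compl_eq_zero fun x hx => ?_
  rw [image_eq_zero_of_notMem_tsupport fun h => hx (hs h), mul_zero]

/-- The fundamental lemma of the calculus of variations; it makes the arbitrary choice in
`weakDeriv` harmless. -/
theorem HasWeakDeriv.ae_eq {I : Fin k → Fin d} {u v w : Euc d → ℝ} (hv : HasWeakDeriv Ω I u v)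
    (hw : HasWeakDeriv Ω I u w) : v =ᵐ[volume.restrict (Ω : Set (Euc d))] w := by
  rw [Filter.EventuallyEq, ae_restrict_iff' Ω.isOpen.measurableSet]
  have key := Ω.isOpen.ae_eq_zero_of_integral_contDiff_smul_eq_zero (hv.2.1.sub hw.2.1) ?_
  · filter_upwards [key] with x hx hxΩ
    simpa [sub_eq_zero] using hx hxΩ
  · intro g hg hc hs
    have h1 := hv.2.2 ⟨g, hg, hc, hs⟩
    rw [hw.2.2 ⟨g, hg, hc, hs⟩] at h1
    have h2 := mul_left_cancel₀ (pow_ne_zero k (by norm_num)) h1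
    simp only [TestFunction.coe_mk] at h2
    rw [setIntegral_mul_eq_integral hs, setIntegral_mul_eq_integral hs] at h2
    have i1 := integrable_mul_of_tsupport_subset hv.2.1 hg.continuous hc hs
    have i2 := integrable_mul_of_tsupport_subset hw.2.1 hg.continuous hc hs
    calc ∫ x, g x • (v - w) x = ∫ x, (v x * g x - w x * g x) := by
          congr 1; ext x; simp; ring
      _ = 0 := by rw [integral_sub i1 i2, h2, sub_self]

theorem HasWeakDeriv.sub {I : Fin k → Fin d} {u u' v v' : Euc d → ℝ} (h : HasWeakDeriv Ω I u v)
    (h' : HasWeakDeriv Ω I u' v') :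
    HasWeakDeriv Ω I (fun x => u x - u' x) (fun x => v x - v' x) := by
  refine ⟨h.1.sub h'.1, h.2.1.sub h'.2.1, fun φ => ?_⟩
  have hψ := contDiff_partialDeriv I φ.contDiff
  have hψc := hasCompactSupport_partialDeriv I φ.hasCompactSupport
  have hψs := (tsupport_partialDeriv_subset I φ).trans φ.tsupport_subset
  simp only [sub_mul]
  rw [integral_sub, integral_sub, h.2.2, h'.2.2, mul_sub]
  · exact (integrable_mul_of_tsupport_subset h.2.1 φ.continuous φ.hasCompactSupport
      φ.tsupport_subset).integrableOn
  · exact (integrable_mul_of_tsupport_subset h'.2.1 φ.continuous φ.hasCompactSupport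
      φ.tsupport_subset).integrableOn
  · exact (integrable_mul_of_tsupport_subset h.1 hψ.continuous hψc hψs).integrableOn
  · exact (integrable_mul_of_tsupport_subset h'.1 hψ.continuous hψc hψs).integrableOn

theorem hasWeakDeriv_of_contDiff (Ω : Opens (Euc d)) (I : Fin k → Fin d) {u : Euc d → ℝ}
    (hu : ContDiff ℝ ∞ u) : HasWeakDeriv Ω I u (partialDeriv I u) := by
  refine ⟨(hu.continuous.locallyIntegrable).locallyIntegrableOn _,
    ((contDiff_partialDeriv I hu).continuous.locallyIntegrable).locallyIntegrableOn _,
    fun φ => ?_⟩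
  rw [setIntegral_mul_eq_integral φ.tsupport_subset, setIntegral_mul_eq_integral
    ((tsupport_partialDeriv_subset I φ).trans φ.tsupport_subset),
    integral_mul_partialDeriv I hu φ.contDiff φ.hasCompactSupport]

theorem hasWeakDeriv_zero_order {u : Euc d → ℝ}
    (hu : LocallyIntegrableOn u (Ω : Set (Euc d))) (I : Fin 0 → Fin d) :
    HasWeakDeriv Ω I u u :=
  ⟨hu, hu, fun φ => by simp [partialDeriv_zero]⟩

theorem HasWeakDeriv.weakDeriv_ae_eq {I : Fin k → Fin d} {u v : Euc d → ℝ}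
    (h : HasWeakDeriv Ω I u v) :
    weakDeriv Ω I u =ᵐ[volume.restrict (Ω : Set (Euc d))] v := by
  have hex : ∃ v, HasWeakDeriv Ω I u v := ⟨v, h⟩
  rw [weakDeriv, dif_pos hex]
  exact hex.choose_spec.ae_eq h

theorem eLpNorm_weakDeriv_le_sobolevNorm {s : ℝ} (hk : k ≤ ⌊s⌋₊) (I : Fin k → Fin d)
    (u : Euc d → ℝ) :
    eLpNorm (weakDeriv Ω I u) 2 (volume.restrict (Ω : Set (Euc d))) ≤ sobolevNorm Ω s u := by
  set a := eLpNorm (weakDeriv Ω I u) 2 (volume.restrict (Ω : Set (Euc d))) with ha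
  have h : a ^ 2 ≤ (∑ k ∈ Finset.range (⌊s⌋₊ + 1), ∑ I : Fin k → Fin d,
      eLpNorm (weakDeriv Ω I u) 2 (volume.restrict (Ω : Set (Euc d))) ^ 2) + fracPartSq Ω s u := by
    refine le_add_right ?_
    refine le_trans ?_ (Finset.single_le_sum (fun _ _ => zero_le)
      (Finset.mem_range.2 (Nat.lt_succ_of_le hk)))
    exact Finset.single_le_sum
      (f := fun I : Fin k → Fin d =>
        eLpNorm (weakDeriv Ω I u) 2 (volume.restrict (Ω : Set (Euc d))) ^ 2)
      (fun _ _ => zero_le) (Finset.mem_univ I)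
  calc a = (a ^ 2) ^ (1 / 2 : ℝ) := by
        rw [← ENNReal.rpow_natCast, ← ENNReal.rpow_mul]; norm_num
    _ ≤ sobolevNorm Ω s u := ENNReal.rpow_le_rpow h (by norm_num)

end WeakDeriv

/-! ### Test functions have finite Sobolev norm -/

section TestFunctionNorm

variable {d k : ℕ} {Ω : Opens (Euc d)}

theorem gagliardoSq_congr_ae {σ : ℝ} {v w : Euc d → ℝ}
    (h : v =ᵐ[volume.restrict (Ω : Set (Euc d))] w) : gagliardoSq Ω σ v = gagliardoSq Ω σ w := by
  refine lintegral_congr_ae ?_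
  filter_upwards [h] with x hx
  refine lintegral_congr_ae ?_
  filter_upwards [h] with y hy
  rw [hx, hy]

theorem gagliardoSq_const_mul (σ c : ℝ) (v : Euc d → ℝ) :
    gagliardoSq Ω σ (fun x => c * v x) = ENNReal.ofReal (c ^ 2) * gagliardoSq Ω σ v := by
  simp only [gagliardoSq]
  rw [← lintegral_const_mul' _ _ ENNReal.ofReal_ne_top]
  refine lintegral_congr fun x => ?_
  rw [← lintegral_const_mul' _ _ ENNReal.ofReal_ne_top]
  refine lintegral_congr fun y => ?_
  rw [← ENNReal.ofReal_mul (sq_nonneg c)]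
  congr 1
  ring

theorem lintegral_ball_norm_rpow_lt_top (hd : 1 ≤ d) {a : ℝ} (ha : -(d : ℝ) < a) {r : ℝ}
    (hr : 0 < r) :
    ∫⁻ z in Metric.ball (0 : Euc d) r, ENNReal.ofReal (‖z‖ ^ a) < ⊤ := by
  have : Nonempty (Fin d) := ⟨⟨0, hd⟩⟩
  have h : IntegrableOn (fun z : Euc d => ‖z‖ ^ a) (Metric.ball (0 : Euc d) r) := by
    rw [integrableOn_fun_norm_addHaar (volume : Measure (Euc d)) (f := fun y : ℝ => y ^ a)]
    have h1 : IntegrableOn (fun y : ℝ => y ^ ((d : ℝ) - 1 + a)) (Ioo 0 r) :=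
      (intervalIntegral.integrableOn_Ioo_rpow_iff hr).2 (by linarith)
    refine h1.congr_fun (fun y hy => ?_) measurableSet_Ioo
    change y ^ ((d : ℝ) - 1 + a) = _
    rw [finrank_euclideanSpace_fin, smul_eq_mul, Real.rpow_add hy.1, ← Real.rpow_natCast,
      Nat.cast_sub hd, Nat.cast_one]
  exact Integrable.lintegral_lt_top h

/-- A Lipschitz bound on `v` cancels two powers of `‖x - y‖`, leaving the exponent `2 - d - 2 σ >
-d`, which is integrable near the origin; boundedness of `Ω` handles the rest. -/
theorem gagliardoSq_lt_top (hd : 1 ≤ d) (hΩ : Bornology.IsBounded (Ω : Set (Euc d))) {σ : ℝ}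
    (hσ : σ < 1) {v : Euc d → ℝ} (hv : ContDiff ℝ 1 v) (hc : HasCompactSupport v) :
    gagliardoSq Ω σ v < ⊤ := by
  obtain ⟨L, hL⟩ := hv.lipschitzWith_of_hasCompactSupport hc (by simp)
  obtain ⟨M, hM0, hM⟩ := hΩ.subset_ball_lt 0 0
  set a : ℝ := 2 - (d + 2 * σ) with ha
  set A : ℝ≥0∞ := ∫⁻ z in Metric.ball (0 : Euc d) (2 * M), ENNReal.ofReal (‖z‖ ^ a) with hA
  have hAtop : A < ⊤ := lintegral_ball_norm_rpow_lt_top hd (by linarith) (by linarith)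
  have hpt : ∀ x ∈ (Ω : Set (Euc d)), ∀ y ∈ (Ω : Set (Euc d)),
      ENNReal.ofReal ((v x - v y) ^ 2 / ‖x - y‖ ^ ((d : ℝ) + 2 * σ)) ≤
        ENNReal.ofReal ((L : ℝ) ^ 2) * (Metric.ball (0 : Euc d) (2 * M)).indicator
          (fun z => ENNReal.ofReal (‖z‖ ^ a)) (x - y) := by
    intro x hx y hy
    have hmem : x - y ∈ Metric.ball (0 : Euc d) (2 * M) := by
      have h1 := hM hx
      have h2 := hM hy
      rw [mem_ball_zero_iff] at *
      linarith [norm_sub_le x y]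
    rw [indicator_of_mem hmem, ← ENNReal.ofReal_mul (by positivity)]
    refine ENNReal.ofReal_le_ofReal ?_
    rcases eq_or_ne x y with rfl | hxy
    · simp only [sub_self, ne_eq, OfNat.ofNat_ne_zero, not_false_eq_true, zero_pow, zero_div]
      positivity
    · have hpos : 0 < ‖x - y‖ := norm_pos_iff.2 (sub_ne_zero.2 hxy)
      have hl : |v x - v y| ≤ L * ‖x - y‖ := by
        simpa [Real.dist_eq, dist_eq_norm] using hL.dist_le_mul x y
      have hsq : (v x - v y) ^ 2 ≤ (L : ℝ) ^ 2 * ‖x - y‖ ^ 2 := by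
        rw [← mul_pow, ← sq_abs (v x - v y)]
        exact pow_le_pow_left₀ (abs_nonneg _) hl 2
      rw [ha, Real.rpow_sub hpos, ← mul_div_assoc]
      exact div_le_div_of_nonneg_right (by simpa using hsq) (by positivity)
  calc gagliardoSq Ω σ v
      ≤ ∫⁻ _ in (Ω : Set (Euc d)), ENNReal.ofReal ((L : ℝ) ^ 2) * A := by
        refine setLIntegral_mono' Ω.isOpen.measurableSet fun x hx => ?_
        calc _ ≤ ∫⁻ y in (Ω : Set (Euc d)), ENNReal.ofReal ((L : ℝ) ^ 2) *
                (Metric.ball (0 : Euc d) (2 * M)).indicator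
                  (fun z => ENNReal.ofReal (‖z‖ ^ a)) (x - y) :=
              setLIntegral_mono' Ω.isOpen.measurableSet (hpt x hx)
          _ ≤ ∫⁻ y, ENNReal.ofReal ((L : ℝ) ^ 2) *
                (Metric.ball (0 : Euc d) (2 * M)).indicator
                  (fun z => ENNReal.ofReal (‖z‖ ^ a)) (x - y) := setLIntegral_le_lintegral _ _
          _ = ENNReal.ofReal ((L : ℝ) ^ 2) * A := by
              rw [lintegral_const_mul' _ _ ENNReal.ofReal_ne_top,
                lintegral_sub_left_eq_self (μ := volume) ((Metric.ball (0 : Euc d) (2 * M)).indicator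
                  (fun z => ENNReal.ofReal (‖z‖ ^ a))) x,
                lintegral_indicator Metric.isOpen_ball.measurableSet]
    _ < ⊤ := by
        rw [setLIntegral_const]
        exact ENNReal.mul_lt_top (ENNReal.mul_lt_top ENNReal.ofReal_lt_top hAtop) hΩ.measure_lt_top

theorem memLp_of_contDiff {f : Euc d → ℝ} (hf : ContDiff ℝ ∞ f) (hc : HasCompactSupport f) :
    MemLp f 2 (volume : Measure (Euc d)) :=
  hf.continuous.memLp_of_hasCompactSupport hc

theorem fracPartSq_lt_top (hd : 1 ≤ d) (hΩ : Bornology.IsBounded (Ω : Set (Euc d))) (s : ℝ)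
    {f : Euc d → ℝ} (hf : ContDiff ℝ ∞ f) (hc : HasCompactSupport f) : fracPartSq Ω s f < ⊤ := by
  unfold fracPartSq
  split_ifs with h
  · simp
  · refine ENNReal.sum_lt_top.2 fun I _ => ?_
    rw [gagliardoSq_congr_ae (hasWeakDeriv_of_contDiff Ω I hf).weakDeriv_ae_eq]
    exact gagliardoSq_lt_top hd hΩ (Int.fract_lt_one s)
      ((contDiff_partialDeriv I hf).of_le (by exact_mod_cast le_top))
      (hasCompactSupport_partialDeriv I hc)

theorem sobolevNorm_lt_top (hd : 1 ≤ d) (hΩ : Bornology.IsBounded (Ω : Set (Euc d))) (s : ℝ)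
    {f : Euc d → ℝ} (hf : ContDiff ℝ ∞ f) (hc : HasCompactSupport f) : sobolevNorm Ω s f < ⊤ := by
  refine ENNReal.rpow_lt_top_of_nonneg (by norm_num) (ENNReal.add_lt_top.2 ⟨?_, ?_⟩).ne
  · refine ENNReal.sum_lt_top.2 fun k _ => ENNReal.sum_lt_top.2 fun I _ => ?_
    rw [eLpNorm_congr_ae (hasWeakDeriv_of_contDiff Ω I hf).weakDeriv_ae_eq]
    exact ENNReal.pow_lt_top ((memLp_of_contDiff (contDiff_partialDeriv I hf)
      (hasCompactSupport_partialDeriv I hc)).restrict _).eLpNorm_lt_top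
  · exact fracPartSq_lt_top hd hΩ s hf hc

theorem weakDeriv_const_mul_ae_eq (I : Fin k → Fin d) {f : Euc d → ℝ} (hf : ContDiff ℝ ∞ f)
    (c : ℝ) :
    weakDeriv Ω I (fun x => c * f x) =ᵐ[volume.restrict (Ω : Set (Euc d))]
      fun x => c * weakDeriv Ω I f x := by
  filter_upwards [(hasWeakDeriv_of_contDiff Ω I (contDiff_const.mul hf)).weakDeriv_ae_eq,
    (hasWeakDeriv_of_contDiff Ω I hf).weakDeriv_ae_eq] with x h1 h2
  rw [h1, h2, partialDeriv_const_mul I hf]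

theorem sobolevNorm_const_mul (s : ℝ) {f : Euc d → ℝ} (hf : ContDiff ℝ ∞ f) (c : ℝ) :
    sobolevNorm Ω s (fun x => c * f x) = ENNReal.ofReal |c| * sobolevNorm Ω s f := by
  have hc : (ENNReal.ofReal (c ^ 2)) ^ (1 / 2 : ℝ) = ENNReal.ofReal |c| := by
    rw [ENNReal.ofReal_rpow_of_nonneg (sq_nonneg c) (by norm_num), ← Real.sqrt_eq_rpow,
      Real.sqrt_sq_eq_abs]
  have h1 : ∀ k : ℕ, ∀ I : Fin k → Fin d,
      eLpNorm (weakDeriv Ω I fun x => c * f x) 2 (volume.restrict (Ω : Set (Euc d))) ^ 2 =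
        ENNReal.ofReal (c ^ 2) *
          eLpNorm (weakDeriv Ω I f) 2 (volume.restrict (Ω : Set (Euc d))) ^ 2 := by
    intro k I
    rw [eLpNorm_congr_ae (weakDeriv_const_mul_ae_eq I hf c)]
    have := eLpNorm_const_smul c (weakDeriv Ω I f) 2 (volume.restrict (Ω : Set (Euc d)))
    rw [show (fun x => c * weakDeriv Ω I f x) = c • weakDeriv Ω I f from rfl, this, mul_pow,
      Real.enorm_eq_ofReal_abs, ← ENNReal.ofReal_pow (abs_nonneg c), sq_abs]
  have h2 : fracPartSq Ω s (fun x => c * f x) = ENNReal.ofReal (c ^ 2) * fracPartSq Ω s f := by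
    unfold fracPartSq
    split_ifs with h
    · simp
    · rw [Finset.mul_sum]
      refine Finset.sum_congr rfl fun I _ => ?_
      rw [gagliardoSq_congr_ae (weakDeriv_const_mul_ae_eq I hf c), gagliardoSq_const_mul]
  unfold sobolevNorm
  rw [← hc, ← ENNReal.mul_rpow_of_nonneg _ _ (by norm_num), h2, mul_add, Finset.mul_sum]
  simp only [h1, Finset.mul_sum]

theorem memSobolevZero_testFunction (hd : 1 ≤ d) (hΩ : Bornology.IsBounded (Ω : Set (Euc d)))
    (s : ℝ) (φ : 𝓓(Ω, ℝ)) : MemSobolevZero Ω s φ := by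
  refine ⟨⟨fun k _ I => ⟨partialDeriv I φ, hasWeakDeriv_of_contDiff Ω I φ.contDiff,
    (memLp_of_contDiff (contDiff_partialDeriv I φ.contDiff)
      (hasCompactSupport_partialDeriv I φ.hasCompactSupport)).restrict _⟩,
    fracPartSq_lt_top hd hΩ s φ.contDiff φ.hasCompactSupport⟩, fun ε hε => ⟨φ, ?_⟩⟩
  -- `φ` approximates itself. The weak derivatives of `φ - φ = 0` are only chosen representatives,
  -- so its norm is read off from homogeneity with factor 0.
  have h := sobolevNorm_const_mul (Ω := Ω) s φ.contDiff 0
  simp only [zero_mul, abs_zero, ENNReal.ofReal_zero] at h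
  simpa [h] using hε

theorem exists_pos_const_mul_mem_sobolevBall (hd : 1 ≤ d)
    (hΩ : Bornology.IsBounded (Ω : Set (Euc d))) (s : ℝ) {R : ℝ} (hR : 0 < R) (φ : 𝓓(Ω, ℝ)) :
    ∃ c : ℝ, 0 < c ∧ (fun x => c * φ x) ∈ sobolevBall Ω s R := by
  obtain ⟨N, hN⟩ : ∃ N : ℝ, sobolevNorm Ω s φ ≤ ENNReal.ofReal N :=
    ⟨_, (ENNReal.ofReal_toReal
      (sobolevNorm_lt_top hd hΩ s φ.contDiff φ.hasCompactSupport).ne).ge⟩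
  -- The summand 1 keeps the denominator positive even when the norm of `φ` vanishes.
  refine ⟨R / (|N| + 1), by positivity, memSobolevZero_testFunction hd hΩ s
    ((R / (|N| + 1)) • φ), ?_⟩
  rw [sobolevNorm_const_mul s φ.contDiff]
  have hc : 0 < R / (|N| + 1) := by positivity
  calc _ ≤ ENNReal.ofReal |R / (|N| + 1)| * ENNReal.ofReal N := by gcongr
    _ = ENNReal.ofReal (R / (|N| + 1) * N) := by
        rw [abs_of_pos hc, ENNReal.ofReal_mul hc.le]
    _ ≤ ENNReal.ofReal R := by
        refine ENNReal.ofReal_le_ofReal ?_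
        rw [div_mul_eq_mul_div, div_le_iff₀ (by positivity)]
        nlinarith [le_abs_self N]

end TestFunctionNorm

/-! ### The upper bound for test functions -/

section UpperBound

variable {d : ℕ} {Ω : Opens (Euc d)} {K : Euc d → ℝ}

/-- The substitution `y = x - β • w` absorbs the factor `β ^ (-d)` and moves all dependence on `β`
into the argument of `f`, extended by zero. -/
theorem regularise_eq_integral_indicator (Ω : Opens (Euc d)) (K : Euc d → ℝ) {β : ℝ} (hβ : 0 < β)
    (f : Euc d → ℝ) (x : Euc d) :
    regularise Ω K β f x = ∫ w, K w * (Ω : Set (Euc d)).indicator f (x - β • w) := by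
  set F : Euc d → ℝ := fun z =>
    scaledKernel K β z * (Ω : Set (Euc d)).indicator f (x - z) with hF
  have h1 : regularise Ω K β f x = ∫ z, F z := by
    rw [regularise, ← integral_indicator Ω.isOpen.measurableSet,
      ← integral_sub_left_eq_self F volume x]
    refine integral_congr_ae (Filter.Eventually.of_forall fun y => ?_)
    simp only [hF, sub_sub_cancel]
    by_cases hy : y ∈ (Ω : Set (Euc d)) <;> simp [hy]
  have h2 := Measure.integral_comp_smul (volume : Measure (Euc d)) F β
  rw [finrank_euclideanSpace_fin, abs_of_pos (by positivity), smul_eq_mul] at h2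
  have h3 : ∫ z, F z = β ^ d * ∫ w, F (β • w) := by
    rw [h2]; field_simp
  rw [h1, h3, ← integral_const_mul]
  refine integral_congr_ae (Filter.Eventually.of_forall fun w => ?_)
  simp only [hF, scaledKernel, smul_smul, inv_mul_cancel₀ hβ.ne', one_smul]
  field_simp

/-- A crude bound that degenerates as `β → 0`; it serves only where `β` is fixed or bounded below.
-/
theorem enorm_regularise_le {M β : ℝ} (hM : ∀ z, |K z| ≤ M) (hβ : 0 < β) (f : Euc d → ℝ)
    (x : Euc d) :
    ‖regularise Ω K β f x‖ₑ ≤ ENNReal.ofReal ((β ^ d)⁻¹ * M) *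
      eLpNorm f 1 (volume.restrict (Ω : Set (Euc d))) := by
  rw [eLpNorm_one_eq_lintegral_enorm, ← lintegral_const_mul' _ _ ENNReal.ofReal_ne_top]
  refine (enorm_integral_le_lintegral_enorm _).trans (lintegral_mono fun y => ?_)
  rw [enorm_mul]
  gcongr
  rw [scaledKernel, Real.enorm_eq_ofReal_abs, abs_mul, abs_of_pos (by positivity)]
  exact ENNReal.ofReal_le_ofReal (mul_le_mul_of_nonneg_left (hM _) (by positivity))

theorem integral_mul_prod_coord_eq_moment {k : ℕ} (K : Euc d → ℝ) (I : Fin k → Fin d) :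
    ∃ r : Fin d → ℕ, ∑ i, r i = k ∧ ∫ w, K w * ∏ j, w (I j) = moment K r := by
  -- The exponent of a coordinate is the number of times its index occurs in `I`.
  refine ⟨fun i => (Finset.univ.filter fun j => I j = i).card, ?_, ?_⟩
  · have := Finset.card_eq_sum_card_fiberwise (f := I) (s := Finset.univ) (t := Finset.univ)
      (by simp)
    simpa using this.symm
  · refine integral_congr_ae (Filter.Eventually.of_forall fun w => ?_)
    simp only
    rw [mul_comm]
    congr 1
    rw [← Finset.prod_fiberwise' Finset.univ I fun i => w i]
    simp [Finset.prod_const]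

theorem integral_mul_iteratedFDeriv_eq_zero (hK : Continuous K) (hc : HasCompactSupport K) {k n : ℕ}
    (hK_vanish : ∀ r : Fin d → ℕ, 1 ≤ ∑ i, r i → ∑ i, r i ≤ n → moment K r = 0)
    (hk : 1 ≤ k) (hkn : k ≤ n) (φ : Euc d → ℝ) (x : Euc d) (b : ℝ) :
    ∫ w, K w * iteratedFDeriv ℝ k φ x (fun _ => b • w) = 0 := by
  have h : ∀ w, K w * iteratedFDeriv ℝ k φ x (fun _ => b • w) =
      ∑ I : Fin k → Fin d, (b ^ k * partialDeriv I φ x) * (K w * ∏ j, w (I j)) := by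
    intro w
    rw [iteratedFDeriv_apply_const_eq_sum, Finset.mul_sum]
    refine Finset.sum_congr rfl fun I _ => ?_
    simp only [PiLp.smul_apply, smul_eq_mul, Finset.prod_mul_distrib, Finset.prod_const,
      Finset.card_univ, Fintype.card_fin]
    ring
  simp only [h]
  rw [integral_finsetSum]
  · refine Finset.sum_eq_zero fun I _ => ?_
    obtain ⟨r, hr, hrI⟩ := integral_mul_prod_coord_eq_moment K I
    rw [integral_const_mul, hrI, hK_vanish r (by omega) (by omega), mul_zero]
  · intro I _
    refine Integrable.const_mul ?_ _
    exact (hK.mul (by fun_prop)).integrable_of_hasCompactSupport hc.mul_right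

theorem abs_iteratedFDeriv_apply_const_le (k : ℕ) (φ : Euc d → ℝ) (z y : Euc d) :
    |iteratedFDeriv ℝ k φ z (fun _ => y)| ≤
      ‖y‖ ^ k * ∑ I : Fin k → Fin d, |partialDeriv I φ z| := by
  rw [iteratedFDeriv_apply_const_eq_sum, Finset.mul_sum]
  refine (Finset.abs_sum_le_sum_abs _ _).trans (Finset.sum_le_sum fun I _ => ?_)
  rw [abs_mul, Finset.abs_prod]
  refine mul_le_mul_of_nonneg_right ?_ (abs_nonneg _)
  calc ∏ j, |y (I j)| ≤ ∏ _j : Fin k, ‖y‖ :=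
        Finset.prod_le_prod (fun _ _ => abs_nonneg _) fun j _ => PiLp.norm_apply_le y (I j)
    _ = ‖y‖ ^ k := by simp

/-- Integral form of the remainder, with `(1 - t) ^ n / n!` estimated by 1. -/
theorem enorm_taylor_remainder_le {φ : Euc d → ℝ} (hφ : ContDiff ℝ ∞ φ) (n : ℕ) (x y : Euc d) :
    ‖φ (x + y) - ∑ k ∈ Finset.range (n + 1),
        (k.factorial : ℝ)⁻¹ * iteratedFDeriv ℝ k φ x (fun _ => y)‖ₑ ≤
      ∫⁻ t in Ioc (0 : ℝ) 1, ‖y‖ₑ ^ (n + 1) *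
        ‖∑ I : Fin (n + 1) → Fin d, |partialDeriv I φ (x + t • y)|‖ₑ := by
  have h := map_add_eq_sum_add_integral_iteratedFDeriv (f := φ) (x := x) (y := y) (n := n)
    (fun t _ => (hφ.of_le (by exact_mod_cast le_top)).contDiffAt)
  simp only [smul_eq_mul] at h
  rw [h, add_sub_cancel_left, intervalIntegral.integral_of_le zero_le_one, enorm_mul]
  have hf : ‖(n.factorial : ℝ)⁻¹‖ₑ ≤ 1 := by
    rw [Real.enorm_eq_ofReal_abs, abs_of_nonneg (by positivity)]
    refine ENNReal.ofReal_le_one.2 (inv_le_one_of_one_le₀ ?_)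
    exact_mod_cast Nat.one_le_iff_ne_zero.2 n.factorial_ne_zero
  refine (mul_le_of_le_one_left zero_le hf).trans
    ((enorm_integral_le_lintegral_enorm _).trans (setLIntegral_mono' measurableSet_Ioc
      fun t ht => ?_))
  have hs : 0 ≤ ∑ I : Fin (n + 1) → Fin d, |partialDeriv I φ (x + t • y)| :=
    Finset.sum_nonneg fun _ _ => abs_nonneg _
  rw [Real.enorm_eq_ofReal_abs, abs_mul, Real.enorm_eq_ofReal_abs, abs_of_nonneg hs,
    ← ofReal_norm, ← ENNReal.ofReal_pow (norm_nonneg _), ← ENNReal.ofReal_mul (by positivity)]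
  refine ENNReal.ofReal_le_ofReal ?_
  have h1 : |(1 - t) ^ n| ≤ 1 := by
    rw [abs_pow]
    exact pow_le_one₀ (abs_nonneg _) (abs_le.2 ⟨by linarith [ht.2], by linarith [ht.1]⟩)
  exact (mul_le_of_le_one_left (abs_nonneg _) h1).trans
    (abs_iteratedFDeriv_apply_const_le (n + 1) φ _ y)

/-- A Minkowski inequality for averages of translates: Cauchy–Schwarz in `p`, then Tonelli, then
translation invariance of Lebesgue measure. -/
theorem eLpNorm_two_le_of_enorm_le_lintegral_translate {P : Type*} [MeasurableSpace P]
    {ν : Measure P} [SFinite ν] {τ : P → Euc d} (hτ : Measurable τ) {G h : Euc d → ℝ}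
    (hG : Continuous G) (hh : ∀ x, ‖h x‖ₑ ≤ ∫⁻ p, ‖G (x - τ p)‖ₑ ∂ν) :
    eLpNorm h 2 volume ≤ ν univ * eLpNorm G 2 volume := by
  have hcs : ∀ g : P → ℝ≥0∞, Measurable g → (∫⁻ p, g p ∂ν) ^ 2 ≤ ν univ * ∫⁻ p, g p ^ 2 ∂ν := by
    intro g hg
    have h1 := ENNReal.lintegral_mul_le_Lp_mul_Lq ν Real.HolderConjugate.two_two
      (f := fun _ => 1) (g := g) aemeasurable_const hg.aemeasurable
    simp only [Pi.mul_apply, one_mul, ENNReal.rpow_two] at h1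
    calc (∫⁻ p, g p ∂ν) ^ 2
        ≤ ((ν univ) ^ (1 / 2 : ℝ) * (∫⁻ p, g p ^ 2 ∂ν) ^ (1 / 2 : ℝ)) ^ 2 := by gcongr; simpa using h1
      _ = ν univ * ∫⁻ p, g p ^ 2 ∂ν := by
        rw [mul_pow, ← ENNReal.rpow_two, ← ENNReal.rpow_two, ← ENNReal.rpow_mul,
          ← ENNReal.rpow_mul]
        norm_num
  have hsq : ∀ f : Euc d → ℝ, eLpNorm f 2 volume = (∫⁻ x, ‖f x‖ₑ ^ 2) ^ (1 / 2 : ℝ) := by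
    intro f
    rw [eLpNorm_eq_lintegral_rpow_enorm_toReal (by norm_num) (by norm_num)]
    simp
  have hmeas : Measurable fun q : Euc d × P => ‖G (q.1 - τ q.2)‖ₑ :=
    (hG.measurable.comp (measurable_fst.sub (hτ.comp measurable_snd))).enorm
  have hint : ∫⁻ x, ‖h x‖ₑ ^ 2 ≤ ν univ ^ 2 * ∫⁻ x, ‖G x‖ₑ ^ 2 := by
    calc ∫⁻ x, ‖h x‖ₑ ^ 2
        ≤ ∫⁻ x, ν univ * ∫⁻ p, ‖G (x - τ p)‖ₑ ^ 2 ∂ν := by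
          refine lintegral_mono fun x => ?_
          exact (pow_le_pow_left₀ zero_le (hh x) 2).trans
            (hcs _ (hmeas.comp measurable_prodMk_left))
      _ = ν univ * ∫⁻ p, ∫⁻ x, ‖G (x - τ p)‖ₑ ^ 2 ∂volume ∂ν := by
          rw [lintegral_const_mul _ ((hmeas.pow_const 2).lintegral_prod_right'),
            lintegral_lintegral_swap (hmeas.pow_const 2).aemeasurable]
      _ = ν univ ^ 2 * ∫⁻ x, ‖G x‖ₑ ^ 2 := by
          have : ∀ p, ∫⁻ x, ‖G (x - τ p)‖ₑ ^ 2 = ∫⁻ x, ‖G x‖ₑ ^ 2 := fun p =>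
            lintegral_sub_right_eq_self (fun x => ‖G x‖ₑ ^ 2) (τ p)
          simp only [this, lintegral_const]
          ring
  rw [hsq, hsq]
  calc _ ≤ (ν univ ^ 2 * ∫⁻ x, ‖G x‖ₑ ^ 2) ^ (1 / 2 : ℝ) :=
        ENNReal.rpow_le_rpow hint (by norm_num)
    _ = _ := by
        rw [ENNReal.mul_rpow_of_nonneg _ _ (by norm_num), ← ENNReal.rpow_two, ← ENNReal.rpow_mul]
        norm_num

/-- The `m`-th absolute moment `∫ |K w| ‖w‖^m dw` of `K`. -/
noncomputable def absMoment (K : Euc d → ℝ) (m : ℕ) : ℝ≥0∞ := ∫⁻ w, ‖K w‖ₑ * ‖w‖ₑ ^ m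

theorem absMoment_lt_top (hK : Continuous K) (hc : HasCompactSupport K) (m : ℕ) :
    absMoment K m < ⊤ := by
  have h : Integrable fun w => K w * ‖w‖ ^ m :=
    (hK.mul (by fun_prop)).integrable_of_hasCompactSupport hc.mul_right
  have h2 := h.2
  simpa [HasFiniteIntegral, enorm_mul, absMoment] using h2

theorem eLpNorm_regularise_sub_le (hK : Continuous K) (hc : HasCompactSupport K)
    (hK_int : ∫ x, K x = 1) {n : ℕ}
    (hK_vanish : ∀ r : Fin d → ℕ, 1 ≤ ∑ i, r i → ∑ i, r i ≤ n → moment K r = 0)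
    {β : ℝ} (hβ : 0 < β) (φ : 𝓓(Ω, ℝ)) :
    eLpNorm (fun x => regularise Ω K β φ x - φ x) 2 (volume.restrict (Ω : Set (Euc d))) ≤
      ENNReal.ofReal (β ^ (n + 1)) * absMoment K (n + 1) * ∑ I : Fin (n + 1) → Fin d,
        eLpNorm (partialDeriv I φ) 2 (volume.restrict (Ω : Set (Euc d))) := by
  set G : Euc d → ℝ := fun z => ∑ I : Fin (n + 1) → Fin d, |partialDeriv I φ z| with hGdef
  have hGc : Continuous G := continuous_finsetSum _ fun I _ =>
    (contDiff_partialDeriv I φ.contDiff).continuous.abs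
  set ρ : Euc d → ℝ≥0∞ := fun w => ENNReal.ofReal (β ^ (n + 1)) * (‖K w‖ₑ * ‖w‖ₑ ^ (n + 1))
    with hρ
  have hρm : Measurable ρ := by
    have := hK.measurable
    fun_prop
  -- The weight of the Taylor remainder becomes a measure in `(w, t)`, so that the remainder is an
  -- average of the translates `G (x - tβw)` and the total mass of `ν` is the required constant.
  set ν : Measure (Euc d × ℝ) :=
    (volume.withDensity ρ).prod (volume.restrict (Ioc (0 : ℝ) 1)) with hν
  have hνuniv : ν univ = ENNReal.ofReal (β ^ (n + 1)) * absMoment K (n + 1) := by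
    rw [hν, ← univ_prod_univ, Measure.prod_prod, withDensity_apply _ MeasurableSet.univ]
    simp [hρ, absMoment, lintegral_const_mul' _ _ ENNReal.ofReal_ne_top]
  have hind : (Ω : Set (Euc d)).indicator φ = φ :=
    indicator_eq_self.2 ((subset_tsupport _).trans φ.tsupport_subset)
  have hpt : ∀ x, ‖regularise Ω K β φ x - φ x‖ₑ ≤
      ∫⁻ p, ‖G (x - (p.2 * β) • p.1)‖ₑ ∂ν := by
    intro x
    set T : Euc d → ℝ := fun w => ∑ k ∈ Finset.range (n + 1),
      (k.factorial : ℝ)⁻¹ * iteratedFDeriv ℝ k φ x (fun _ => (-β) • w) with hT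
    have hik : ∀ k, Integrable fun w => K w * iteratedFDeriv ℝ k φ x (fun _ => (-β) • w) := by
      intro k
      exact (hK.mul ((iteratedFDeriv ℝ k φ x).cont.comp (by fun_prop))).integrable_of_hasCompactSupport
        hc.mul_right
    have hTi : Integrable fun w => K w * T w := by
      simp only [hT, Finset.mul_sum, mul_left_comm (K _)]
      exact integrable_finsetSum _ fun k _ => (hik k).const_mul _
    -- Only the term of order 0 survives: the orders 1 to `n` are combinations of vanishing moments.
    have hTint : ∫ w, K w * T w = φ x := by
      simp only [hT, Finset.mul_sum, mul_left_comm (K _)]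
      rw [integral_finsetSum _ fun k _ => (hik k).const_mul _, Finset.sum_range_succ',
        Finset.sum_eq_zero]
      · simp [integral_mul_const, hK_int]
      · intro k hk
        rw [integral_const_mul, integral_mul_iteratedFDeriv_eq_zero hK hc hK_vanish (by omega)
          (by have := Finset.mem_range.1 hk; omega), mul_zero]
    have hreg : regularise Ω K β φ x - φ x = ∫ w, K w * (φ (x + (-β) • w) - T w) := by
      rw [regularise_eq_integral_indicator Ω K hβ, hind]
      simp only [mul_sub]
      rw [integral_sub _ hTi, hTint]
      · simp [sub_eq_add_neg]
      · have := φ.continuous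
        exact (hK.mul (by fun_prop)).integrable_of_hasCompactSupport hc.mul_right
    have hGm : Measurable fun p : Euc d × ℝ => ‖G (x - (p.2 * β) • p.1)‖ₑ := by
      have : Continuous fun p : Euc d × ℝ => G (x - (p.2 * β) • p.1) := by fun_prop
      exact this.measurable.enorm
    rw [hν, lintegral_prod _ hGm.aemeasurable, lintegral_withDensity_eq_lintegral_mul _ hρm
      hGm.lintegral_prod_right', hreg]
    refine (enorm_integral_le_lintegral_enorm _).trans (lintegral_mono fun w => ?_)
    rw [enorm_mul, Pi.mul_apply]
    refine (mul_le_mul_right (enorm_taylor_remainder_le φ.contDiff n x ((-β) • w)) _).trans ?_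
    rw [lintegral_const_mul' _ _ (by simp), ← mul_assoc]
    refine mul_le_mul' (le_of_eq ?_) (le_of_eq ?_)
    · simp only [hρ]
      rw [enorm_smul, mul_pow, enorm_neg, Real.enorm_of_nonneg hβ.le,
        ENNReal.ofReal_pow hβ.le]
      ring
    · refine lintegral_congr fun t => ?_
      simp only [hGdef]
      rw [smul_smul, mul_neg, neg_smul, ← sub_eq_add_neg]
  calc eLpNorm (fun x => regularise Ω K β φ x - φ x) 2 (volume.restrict (Ω : Set (Euc d)))
      ≤ eLpNorm (fun x => regularise Ω K β φ x - φ x) 2 volume :=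
        eLpNorm_mono_measure _ Measure.restrict_le_self
    _ ≤ ν univ * eLpNorm G 2 volume :=
        eLpNorm_two_le_of_enorm_le_lintegral_translate (by fun_prop) hGc hpt
    _ ≤ _ := by
        rw [hνuniv]
        gcongr
        have hG : G = ∑ I : Fin (n + 1) → Fin d, fun z => |partialDeriv I φ z| := by
          ext z; simp [hGdef]
        rw [hG]
        refine (eLpNorm_sum_le (fun I _ =>
          (contDiff_partialDeriv I φ.contDiff).continuous.abs.aestronglyMeasurable)
          (by norm_num)).trans (Finset.sum_le_sum fun I _ => ?_)
        -- Translation invariance required norms over the whole space; the support of `φ` lies in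
        -- `Ω`, so these equal the norms over `Ω`.
        rw [eLpNorm_restrict_eq_of_support_subset ((subset_tsupport _).trans
          ((tsupport_partialDeriv_subset I φ).trans φ.tsupport_subset))]
        exact (eLpNorm_norm (partialDeriv I φ)).le

end UpperBound

/-! ### Passage to the closure of the test functions -/

section Density

variable {d : ℕ} {Ω : Opens (Euc d)} {K : Euc d → ℝ}

theorem MemSobolev.hasWeakDeriv_weakDeriv_memLp {s : ℝ} {f : Euc d → ℝ} (hf : MemSobolev Ω s f)
    {k : ℕ} (hk : k ≤ ⌊s⌋₊) (I : Fin k → Fin d) :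
    ∃ v, HasWeakDeriv Ω I f v ∧ MemLp v 2 (volume.restrict (Ω : Set (Euc d))) ∧
      weakDeriv Ω I f =ᵐ[volume.restrict (Ω : Set (Euc d))] v := by
  obtain ⟨v, hv, hv2⟩ := hf.1 k hk I
  exact ⟨v, hv, hv2, hv.weakDeriv_ae_eq⟩

theorem MemSobolev.memLp {s : ℝ} {f : Euc d → ℝ} (hf : MemSobolev Ω s f) :
    MemLp f 2 (volume.restrict (Ω : Set (Euc d))) := by
  obtain ⟨v, hv, hv2⟩ := hf.1 0 (Nat.zero_le _) Fin.elim0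
  exact hv2.ae_eq (hv.ae_eq (hasWeakDeriv_zero_order hv.1 _))

theorem eLpNorm_sub_testFunction_le {s : ℝ} {f : Euc d → ℝ} (hf : MemSobolev Ω s f)
    (φ : 𝓓(Ω, ℝ)) :
    eLpNorm (fun x => f x - φ x) 2 (volume.restrict (Ω : Set (Euc d))) ≤
      sobolevNorm Ω s fun x => f x - φ x := by
  obtain ⟨v, hv, -⟩ := hf.1 0 (Nat.zero_le _) Fin.elim0
  have h : HasWeakDeriv Ω Fin.elim0 (fun x => f x - φ x) (fun x => f x - φ x) :=
    hasWeakDeriv_zero_order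
      (hv.1.sub ((φ.continuous.locallyIntegrable).locallyIntegrableOn _)) _
  rw [← eLpNorm_congr_ae h.weakDeriv_ae_eq]
  exact eLpNorm_weakDeriv_le_sobolevNorm (Nat.zero_le _) _ _

/-- The triangle inequality between the weak derivatives of `f` and of `f - φ`: an approximant
inherits the bound of `f` up to the approximation error. -/
theorem eLpNorm_partialDeriv_le {s : ℝ} {f : Euc d → ℝ} (hf : MemSobolev Ω s f) (φ : 𝓓(Ω, ℝ))
    {k : ℕ} (hk : k ≤ ⌊s⌋₊) (I : Fin k → Fin d) :
    eLpNorm (partialDeriv I φ) 2 (volume.restrict (Ω : Set (Euc d))) ≤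
      sobolevNorm Ω s f + sobolevNorm Ω s fun x => f x - φ x := by
  obtain ⟨v, hv, hv2, hvw⟩ := hf.hasWeakDeriv_weakDeriv_memLp hk I
  have hφ := hasWeakDeriv_of_contDiff Ω I φ.contDiff
  have hφ2 : MemLp (partialDeriv I φ) 2 (volume.restrict (Ω : Set (Euc d))) :=
    (memLp_of_contDiff (contDiff_partialDeriv I φ.contDiff)
      (hasCompactSupport_partialDeriv I φ.hasCompactSupport)).restrict _
  calc eLpNorm (partialDeriv I φ) 2 (volume.restrict (Ω : Set (Euc d)))
      = eLpNorm (v - fun x => v x - partialDeriv I φ x) 2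
          (volume.restrict (Ω : Set (Euc d))) := by
        congr 1; ext x; simp
    _ ≤ eLpNorm v 2 (volume.restrict (Ω : Set (Euc d))) +
          eLpNorm (fun x => v x - partialDeriv I φ x) 2 (volume.restrict (Ω : Set (Euc d))) :=
        eLpNorm_sub_le hv2.1 (hv2.1.sub hφ2.1) (by norm_num)
    _ ≤ _ := by
        rw [← eLpNorm_congr_ae hvw, ← eLpNorm_congr_ae (hv.sub hφ).weakDeriv_ae_eq]
        exact add_le_add (eLpNorm_weakDeriv_le_sobolevNorm hk _ _)
          (eLpNorm_weakDeriv_le_sobolevNorm hk _ _)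

theorem integrable_scaledKernel_mul (hΩ : Bornology.IsBounded (Ω : Set (Euc d)))
    (hK : Continuous K) {M : ℝ} (hM : ∀ z, |K z| ≤ M) {β : ℝ} (hβ : 0 < β) {f : Euc d → ℝ}
    (hf : MemLp f 2 (volume.restrict (Ω : Set (Euc d)))) (x : Euc d) :
    IntegrableOn (fun y => scaledKernel K β (x - y) * f y) (Ω : Set (Euc d)) := by
  have : IsFiniteMeasure (volume.restrict (Ω : Set (Euc d))) :=
    ⟨by simpa using hΩ.measure_lt_top⟩
  refine (hf.integrable (by norm_num)).bdd_mul (c := (β ^ d)⁻¹ * M) ?_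
    (Filter.Eventually.of_forall fun y => ?_)
  · unfold scaledKernel
    exact Continuous.aestronglyMeasurable (by fun_prop)
  · rw [scaledKernel, Real.norm_eq_abs, abs_mul, abs_of_pos (by positivity)]
    exact mul_le_mul_of_nonneg_left (hM _) (by positivity)

theorem aestronglyMeasurable_regularise (hK : Continuous K) (β : ℝ) {f : Euc d → ℝ}
    (hf : AEStronglyMeasurable f (volume.restrict (Ω : Set (Euc d)))) :
    AEStronglyMeasurable (regularise Ω K β f) (volume.restrict (Ω : Set (Euc d))) := by
  refine AEStronglyMeasurable.integral_prod_right'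
    (f := fun q : Euc d × Euc d => scaledKernel K β (q.1 - q.2) * f q.2) ?_
  refine AEStronglyMeasurable.mul (Continuous.aestronglyMeasurable ?_) hf.comp_snd
  unfold scaledKernel
  fun_prop

theorem eLpNorm_regularise_le {M β : ℝ} (hM : ∀ z, |K z| ≤ M) (hβ : 0 < β) (f : Euc d → ℝ) :
    eLpNorm (regularise Ω K β f) 2 (volume.restrict (Ω : Set (Euc d))) ≤
      ENNReal.ofReal ((β ^ d)⁻¹ * M) * volume (Ω : Set (Euc d)) ^ (1 / 2 : ℝ) *
        eLpNorm f 1 (volume.restrict (Ω : Set (Euc d))) := by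
  refine (eLpNorm_mono_enorm (g := fun _ => ENNReal.ofReal ((β ^ d)⁻¹ * M) *
      eLpNorm f 1 (volume.restrict (Ω : Set (Euc d)))) fun x => ?_).trans ?_
  · simpa using enorm_regularise_le hM hβ f x
  · rw [eLpNorm_const' _ (by norm_num) (by norm_num)]
    simp only [enorm_eq_self, Measure.restrict_apply_univ]
    norm_num
    exact le_of_eq (by ring)

theorem eLpNorm_one_le_eLpNorm_two_mul {f : Euc d → ℝ}
    (hf : AEStronglyMeasurable f (volume.restrict (Ω : Set (Euc d)))) :
    eLpNorm f 1 (volume.restrict (Ω : Set (Euc d))) ≤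
      eLpNorm f 2 (volume.restrict (Ω : Set (Euc d))) * volume (Ω : Set (Euc d)) ^ (1 / 2 : ℝ) := by
  have := eLpNorm_le_eLpNorm_mul_rpow_measure_univ (p := 1) (q := 2) (by norm_num) hf
  norm_num at this
  simpa using this

theorem eLpNorm_regularise_sub_le_of_mem_sobolevBall
    (hΩ : Bornology.IsBounded (Ω : Set (Euc d))) (hK : Continuous K) (hc : HasCompactSupport K)
    (hK_int : ∫ x, K x = 1) {n : ℕ}
    (hK_vanish : ∀ r : Fin d → ℕ, 1 ≤ ∑ i, r i → ∑ i, r i ≤ n → moment K r = 0)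
    {s R : ℝ} (hs : n + 1 ≤ ⌊s⌋₊) {β : ℝ} (hβ : 0 < β) {f : Euc d → ℝ}
    (hf : f ∈ sobolevBall Ω s R) :
    eLpNorm (fun x => regularise Ω K β f x - f x) 2 (volume.restrict (Ω : Set (Euc d))) ≤
      ENNReal.ofReal (β ^ (n + 1)) * absMoment K (n + 1) *
        (Fintype.card (Fin (n + 1) → Fin d) * ENNReal.ofReal R) := by
  obtain ⟨⟨hfS, hf0⟩, hfR⟩ := hf
  obtain ⟨M, hM⟩ := hc.exists_bound_of_continuous hK
  have hf2 := hfS.memLp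
  set N : ℝ≥0∞ := ((Fintype.card (Fin (n + 1) → Fin d) : ℕ) : ℝ≥0∞)
  set A := ENNReal.ofReal (β ^ (n + 1)) * absMoment K (n + 1) with hA
  set B := ENNReal.ofReal ((β ^ d)⁻¹ * M) * volume (Ω : Set (Euc d)) ^ (1 / 2 : ℝ) *
    volume (Ω : Set (Euc d)) ^ (1 / 2 : ℝ) with hB
  have hvol : volume (Ω : Set (Euc d)) ^ (1 / 2 : ℝ) ≠ ⊤ :=
    ENNReal.rpow_ne_top_of_nonneg (by norm_num) hΩ.measure_lt_top.ne
  have hBtop : B ≠ ⊤ := ENNReal.mul_ne_top (ENNReal.mul_ne_top ENNReal.ofReal_ne_top hvol) hvol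
  have hAtop : A ≠ ⊤ := ENNReal.mul_ne_top ENNReal.ofReal_ne_top (absMoment_lt_top hK hc _).ne
  -- Split `f = φ + (f - φ)`: the estimate for test functions gives the main term, and the
  -- convolution of `f - φ` costs `B * ε`. The constant `B` blows up as `β → 0`, but `β` is fixed
  -- while `ε` tends to 0.
  have key : ∀ ε : ℝ≥0∞, 0 < ε →
      eLpNorm (fun x => regularise Ω K β f x - f x) 2 (volume.restrict (Ω : Set (Euc d))) ≤
        A * (N * ENNReal.ofReal R) + (A * N + B + 1) * ε := by
    intro ε hε
    obtain ⟨φ, hφ⟩ := hf0 ε hε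
    have hφ2 : MemLp φ 2 (volume.restrict (Ω : Set (Euc d))) :=
      (memLp_of_contDiff φ.contDiff φ.hasCompactSupport).restrict _
    have hg2 : MemLp (fun x => f x - φ x) 2 (volume.restrict (Ω : Set (Euc d))) := hf2.sub hφ2
    have hgε := (eLpNorm_sub_testFunction_le hfS φ).trans hφ.le
    have hlin : (fun x => regularise Ω K β f x - f x) =
        ((fun x => regularise Ω K β φ x - φ x) + regularise Ω K β fun x => f x - φ x)
          - fun x => f x - φ x := by
      ext x
      have : regularise Ω K β (fun x => f x - φ x) x =
          regularise Ω K β f x - regularise Ω K β φ x := by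
        simp only [regularise, mul_sub]
        exact integral_sub (integrable_scaledKernel_mul hΩ hK hM hβ hf2 x)
          (integrable_scaledKernel_mul hΩ hK hM hβ hφ2 x)
      simp only [Pi.sub_apply, Pi.add_apply, this]
      ring
    have m1 := (aestronglyMeasurable_regularise (Ω := Ω) hK β hφ2.1).sub hφ2.1
    have m2 := aestronglyMeasurable_regularise (Ω := Ω) hK β hg2.1
    have e1 : eLpNorm (fun x => regularise Ω K β φ x - φ x) 2
        (volume.restrict (Ω : Set (Euc d))) ≤ A * (N * (ENNReal.ofReal R + ε)) := by
      refine (eLpNorm_regularise_sub_le hK hc hK_int hK_vanish hβ φ).trans ?_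
      gcongr
      calc _ ≤ ∑ _I : Fin (n + 1) → Fin d, (ENNReal.ofReal R + ε) :=
            Finset.sum_le_sum fun I _ =>
              (eLpNorm_partialDeriv_le hfS φ hs I).trans (add_le_add hfR hφ.le)
        _ = N * (ENNReal.ofReal R + ε) := by
            rw [Finset.sum_const, nsmul_eq_mul]; rfl
    have e2 : eLpNorm (regularise Ω K β fun x => f x - φ x) 2
        (volume.restrict (Ω : Set (Euc d))) ≤ B * ε := by
      refine (eLpNorm_regularise_le hM hβ _).trans ?_
      rw [hB, mul_assoc _ _ ε]
      gcongr
      refine (eLpNorm_one_le_eLpNorm_two_mul hg2.1).trans ?_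
      rw [mul_comm]
      gcongr
    rw [hlin]
    calc _ ≤ A * (N * (ENNReal.ofReal R + ε)) + B * ε + ε :=
          (eLpNorm_sub_le (m1.add m2) hg2.1 (by norm_num)).trans
            (add_le_add ((eLpNorm_add_le m1 m2 (by norm_num)).trans (add_le_add e1 e2)) hgε)
      _ = _ := by ring
  have hDtop : A * N + B + 1 ≠ ⊤ := by
    refine ENNReal.add_ne_top.2 ⟨ENNReal.add_ne_top.2 ⟨ENNReal.mul_ne_top hAtop ?_, hBtop⟩, by simp⟩
    exact ENNReal.natCast_ne_top _
  refine ENNReal.le_of_forall_pos_le_add fun δ hδ _ => ?_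
  refine (key (δ / (A * N + B + 1))
    (ENNReal.div_pos (by exact_mod_cast hδ.ne') hDtop)).trans (add_le_add le_rfl ?_)
  exact ENNReal.mul_div_le

end Density

/-! ### The lower bound, for small and for large β -/

section LowerBound

variable {d : ℕ} {Ω : Opens (Euc d)} {K : Euc d → ℝ}

theorem regularise_const_mul (β c : ℝ) (f : Euc d → ℝ) (x : Euc d) :
    regularise Ω K β (fun y => c * f y) x = c * regularise Ω K β f x := by
  simp only [regularise, mul_left_comm _ c]
  exact integral_const_mul _ _

/-- A fixed test function is scaled into the ball once, by a factor that does not depend on `β`;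
lower bounds then need only one well-chosen function. -/
theorem exists_const_mul_eLpNorm_le_worstError (hd : 1 ≤ d)
    (hΩ : Bornology.IsBounded (Ω : Set (Euc d))) (K : Euc d → ℝ) (s : ℝ) {R : ℝ} (hR : 0 < R)
    (φ : 𝓓(Ω, ℝ)) :
    ∃ c : ℝ, 0 < c ∧ ∀ β, ENNReal.ofReal c *
      eLpNorm (fun x => regularise Ω K β φ x - φ x) 2 (volume.restrict (Ω : Set (Euc d))) ≤
        worstError Ω K s R β := by
  obtain ⟨c, hc, hmem⟩ := exists_pos_const_mul_mem_sobolevBall hd hΩ s hR φ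
  refine ⟨c, hc, fun β => ?_⟩
  refine le_trans (le_of_eq ?_) (le_iSup₂ (f := fun f (_ : f ∈ sobolevBall Ω s R) =>
    eLpNorm (fun x => regularise Ω K β f x - f x) 2 (volume.restrict (Ω : Set (Euc d)))) _ hmem)
  simp only [regularise_const_mul, ← mul_sub]
  rw [← Real.enorm_of_nonneg hc.le, ← eLpNorm_const_smul]
  rfl

/-- Expand every power by the binomial theorem. A multi-index `j ≤ r` other than `0` and `r` has
order between 1 and `n`, so its moment vanishes. -/
theorem integral_mul_prod_sub_pow (hK : Continuous K) (hc : HasCompactSupport K)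
    (hK_int : ∫ x, K x = 1) {n : ℕ}
    (hK_vanish : ∀ r : Fin d → ℕ, 1 ≤ ∑ i, r i → ∑ i, r i ≤ n → moment K r = 0)
    {r : Fin d → ℕ} (hr : ∑ i, r i = n + 1) (a : Fin d → ℝ) (β : ℝ) :
    ∫ w, K w * ∏ i, (a i - β * w i) ^ r i =
      ∏ i, a i ^ r i + (-β) ^ (n + 1) * moment K r := by
  set S := Fintype.piFinset fun i => Finset.range (r i + 1) with hS
  set C : (Fin d → ℕ) → ℝ := fun j =>
    ∏ i, ((-β) ^ j i * a i ^ (r i - j i) * ((r i).choose (j i) : ℝ)) with hC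
  have h : ∀ w : Euc d, K w * ∏ i, (a i - β * w i) ^ r i =
      ∑ j ∈ S, C j * ((∏ i, w i ^ j i) * K w) := by
    intro w
    have h1 : ∀ i, (a i - β * w i) ^ r i = ∑ m ∈ Finset.range (r i + 1),
        ((-β) ^ m * a i ^ (r i - m) * ((r i).choose m : ℝ)) * w i ^ m := by
      intro i
      rw [show a i - β * w i = (-β) * w i + a i by ring, add_pow]
      refine Finset.sum_congr rfl fun m _ => ?_
      rw [mul_pow]; ring
    simp only [h1]
    rw [Finset.prod_univ_sum, Finset.mul_sum]
    refine Finset.sum_congr rfl fun j _ => ?_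
    rw [Finset.prod_mul_distrib]
    ring
  simp only [h]
  rw [integral_finsetSum]
  · simp only [integral_const_mul]
    change ∑ j ∈ S, C j * moment K j = _
    have hr0 : (0 : Fin d → ℕ) ≠ r := by
      rintro rfl
      simp at hr
    rw [Finset.sum_eq_add_of_mem (0 : Fin d → ℕ) r (by simp [hS]) (by simp [hS]) hr0]
    · congr 1
      · simp [hC, moment, hK_int]
      · congr 1
        simp [hC, Finset.prod_pow_eq_pow_sum, hr]
    · intro j hj hne
      have hle : ∀ i, j i ≤ r i := fun i => by
        have := Fintype.mem_piFinset.1 hj i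
        have := Finset.mem_range.1 this
        omega
      have h1 : 1 ≤ ∑ i, j i := by
        by_contra h0
        have h0 : ∑ i, j i = 0 := by omega
        refine hne.1 (funext fun i => ?_)
        exact Finset.sum_eq_zero_iff.1 h0 i (Finset.mem_univ i)
      have h2 : ∑ i, j i < ∑ i, r i := by
        refine lt_of_le_of_ne (Finset.sum_le_sum fun i _ => hle i) fun heq => hne.2 ?_
        exact funext fun i =>
          (Finset.sum_eq_sum_iff_of_le fun i _ => hle i).1 heq i (Finset.mem_univ i)
      rw [hK_vanish j h1 (by omega), mul_zero]
  · intro j _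
    refine Integrable.const_mul ?_ _
    exact (Continuous.mul (by fun_prop) hK).integrable_of_hasCompactSupport hc.mul_left

theorem exists_testFunction_eq_prod_pow {x₀ : Euc d} {ρ : ℝ} (hρ : 0 < ρ)
    (hball : Metric.closedBall x₀ (3 * ρ) ⊆ Ω) (r : Fin d → ℕ) :
    ∃ φ : 𝓓(Ω, ℝ), ∀ y ∈ Metric.closedBall x₀ (2 * ρ), φ y = ∏ i, (y i - x₀ i) ^ r i := by
  let χ : ContDiffBump x₀ := ⟨2 * ρ, 3 * ρ, by linarith, by linarith⟩
  have hp : ContDiff ℝ ∞ fun y : Euc d => ∏ i, (y i - x₀ i) ^ r i := by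
    refine contDiff_prod fun i _ => ContDiff.pow (ContDiff.sub ?_ contDiff_const) _
    fun_prop
  refine ⟨⟨fun y => χ y * ∏ i, (y i - x₀ i) ^ r i, χ.contDiff.mul hp,
    χ.hasCompactSupport.mul_right, ?_⟩, fun y hy => ?_⟩
  · exact (tsupport_mul_subset_left).trans (χ.tsupport_eq.trans_subset hball)
  · simp only [TestFunction.coe_mk]
    rw [χ.one_of_mem_closedBall hy, one_mul]

theorem exists_lower_bound_small (hd : 1 ≤ d) (hΩ_nonempty : (Ω : Set (Euc d)).Nonempty)
    (hΩ : Bornology.IsBounded (Ω : Set (Euc d))) (hK : Continuous K) (hc : HasCompactSupport K)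
    (hK_int : ∫ x, K x = 1) {n : ℕ}
    (hK_vanish : ∀ r : Fin d → ℕ, 1 ≤ ∑ i, r i → ∑ i, r i ≤ n → moment K r = 0)
    (hK_nonvanish : ∃ r : Fin d → ℕ, ∑ i, r i = n + 1 ∧ moment K r ≠ 0)
    (s : ℝ) {R : ℝ} (hR : 0 < R) :
    ∃ β₁ > 0, ∃ c : ℝ, 0 < c ∧ ∀ β : ℝ, 0 < β → β ≤ β₁ →
      ENNReal.ofReal (c * β ^ (n + 1)) ≤ worstError Ω K s R β := by
  obtain ⟨x₀, hx₀⟩ := hΩ_nonempty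
  obtain ⟨r, hr, hrne⟩ := hK_nonvanish
  obtain ⟨ρ', hρ', hρΩ⟩ := Metric.nhds_basis_closedBall.mem_iff.1 (Ω.isOpen.mem_nhds hx₀)
  -- The test function lives in radius `3ρ` and is a monomial in radius `2ρ`; points `x` in radius
  -- `ρ`, shifted by at most `ρ`, stay in the monomial region.
  obtain ⟨ρ, rfl⟩ : ∃ ρ, ρ' = 3 * ρ := ⟨ρ' / 3, by ring⟩
  have hρ : 0 < ρ := by linarith
  obtain ⟨T, hT0, hT⟩ := hc.isBounded.subset_ball_lt 0 0
  obtain ⟨φ, hφ⟩ := exists_testFunction_eq_prod_pow hρ hρΩ r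
  obtain ⟨c, hc0, hcle⟩ := exists_const_mul_eLpNorm_le_worstError hd hΩ K s hR φ
  have hsub : Metric.ball x₀ ρ ⊆ (Ω : Set (Euc d)) :=
    (Metric.ball_subset_closedBall.trans
      (Metric.closedBall_subset_closedBall (by linarith))).trans hρΩ
  have hind : (Ω : Set (Euc d)).indicator φ = φ :=
    indicator_eq_self.2 ((subset_tsupport _).trans φ.tsupport_subset)
  set V : ℝ≥0∞ := volume (Metric.ball x₀ ρ) ^ (1 / 2 : ℝ) with hV
  have hVpos : 0 < V := ENNReal.rpow_pos (Metric.measure_ball_pos _ _ hρ)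
    measure_ball_lt_top.ne
  have hVtop : V ≠ ⊤ := ENNReal.rpow_ne_top_of_nonneg (by norm_num) measure_ball_lt_top.ne
  -- The support of `K` lies in the ball of radius `T`, so `β ≤ ρ / T` keeps every relevant shift `β
  -- • w` within `ρ`. The constant is the exact L² norm of the error over the ball of radius `ρ`,
  -- without the power of `β` and scaled by `c`.
  refine ⟨ρ / T, by positivity, c * |moment K r| * V.toReal, ?_, fun β hβ hβ1 => ?_⟩
  · have := ENNReal.toReal_pos hVpos.ne' hVtop
    have := abs_pos.2 hrne
    positivity
  have hpt : ∀ x ∈ Metric.ball x₀ ρ,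
      regularise Ω K β φ x - φ x = (-β) ^ (n + 1) * moment K r := by
    intro x hx
    rw [Metric.mem_ball, dist_eq_norm] at hx
    have hφx : φ x = ∏ i, (x i - x₀ i) ^ r i := by
      refine hφ x ?_
      rw [Metric.mem_closedBall, dist_eq_norm]
      linarith
    rw [regularise_eq_integral_indicator Ω K hβ, hind, hφx, sub_eq_iff_eq_add',
      ← integral_mul_prod_sub_pow hK hc hK_int hK_vanish hr]
    refine integral_congr_ae (Filter.Eventually.of_forall fun w => ?_)
    by_cases hw : K w = 0
    · simp [hw]
    · have hwT : ‖w‖ < T := mem_ball_zero_iff.1 (hT (subset_tsupport _ hw))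
      have hβw : ‖β • w‖ ≤ ρ := by
        rw [norm_smul, Real.norm_eq_abs, abs_of_pos hβ]
        calc β * ‖w‖ ≤ ρ / T * T := by gcongr
          _ = ρ := by field_simp
      simp only
      rw [hφ (x - β • w)]
      · congr 1
        refine Finset.prod_congr rfl fun i _ => ?_
        simp only [PiLp.sub_apply, PiLp.smul_apply, smul_eq_mul]
        ring
      · rw [Metric.mem_closedBall, dist_eq_norm, sub_right_comm]
        linarith [norm_sub_le (x - x₀) (β • w)]
  refine le_trans ?_ (hcle β)
  calc ENNReal.ofReal (c * |moment K r| * V.toReal * β ^ (n + 1))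
      = ENNReal.ofReal c * (‖(-β) ^ (n + 1) * moment K r‖ₑ * V) := by
        rw [Real.enorm_eq_ofReal_abs, abs_mul, abs_pow, abs_neg, abs_of_pos hβ,
          ← ENNReal.ofReal_toReal hVtop, ← ENNReal.ofReal_mul (by positivity),
          ← ENNReal.ofReal_mul hc0.le, ENNReal.toReal_ofReal (by positivity)]
        congr 1
        ring
    _ = ENNReal.ofReal c * eLpNorm (fun x => regularise Ω K β φ x - φ x) 2
          (volume.restrict (Metric.ball x₀ ρ)) := by
        congr 1
        rw [eLpNorm_congr_ae (g := fun _ => (-β) ^ (n + 1) * moment K r),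
          eLpNorm_const' _ (by norm_num) (by norm_num)]
        · simp [hV]
        · exact (ae_restrict_iff' Metric.isOpen_ball.measurableSet).2
            (Filter.Eventually.of_forall hpt)
    _ ≤ _ := by
        gcongr

/-- Concentration: for a bump supported in a set `W`, Cauchy–Schwarz gives `‖φ‖₁ ≤ |W|^(1/2) ‖φ‖₂`,
and `W` can be taken arbitrarily small around a point. -/
theorem exists_testFunction_eLpNorm_one_le (hd : 1 ≤ d)
    (hΩ_nonempty : (Ω : Set (Euc d)).Nonempty) {ε : ℝ≥0∞} (hε : 0 < ε) :
    ∃ φ : 𝓓(Ω, ℝ), 0 < eLpNorm φ 2 (volume.restrict (Ω : Set (Euc d))) ∧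
      eLpNorm φ 1 (volume.restrict (Ω : Set (Euc d))) ≤
        ε * eLpNorm φ 2 (volume.restrict (Ω : Set (Euc d))) := by
  obtain ⟨x₀, hx₀⟩ := hΩ_nonempty
  have : Nonempty (Fin d) := ⟨⟨0, hd⟩⟩
  -- Outer regularity at a single point, which is a null set because `d ≥ 1`.
  obtain ⟨U, hU, hUo, hUε⟩ := Set.exists_isOpen_lt_of_lt ({x₀} : Set (Euc d))
    (ε ^ (2 : ℝ)) (μ := volume) (by
      rw [measure_singleton]
      exact ENNReal.rpow_pos_of_nonneg hε zero_le_two)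
  set W : Opens (Euc d) := ⟨U, hUo⟩ ⊓ Ω with hW
  have hxW : x₀ ∈ (W : Set (Euc d)) := ⟨hU rfl, hx₀⟩
  obtain ⟨ρ, hρ, hρW⟩ := Metric.nhds_basis_closedBall.mem_iff.1 (W.isOpen.mem_nhds hxW)
  let χ : ContDiffBump x₀ := ⟨ρ / 2, ρ, by linarith, by linarith⟩
  have hχW : Function.support χ ⊆ W :=
    (subset_tsupport _).trans (χ.tsupport_eq.trans_subset hρW)
  have hχΩ : Function.support χ ⊆ Ω := hχW.trans inter_subset_right
  refine ⟨⟨χ, χ.contDiff, χ.hasCompactSupport,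
    χ.tsupport_eq.trans_subset (hρW.trans inter_subset_right)⟩, ?_, ?_⟩
  · simp only [TestFunction.coe_mk]
    rw [eLpNorm_restrict_eq_of_support_subset hχΩ, pos_iff_ne_zero, Ne,
      eLpNorm_eq_zero_iff χ.continuous.aestronglyMeasurable (by norm_num)]
    intro h
    have h0 := (χ.continuous.ae_eq_iff_eq volume continuous_zero).1 h
    have h1 := χ.one_of_mem_closedBall (Metric.mem_closedBall_self χ.rIn_pos.le)
    rw [h0] at h1
    simp at h1
  · simp only [TestFunction.coe_mk]
    rw [eLpNorm_restrict_eq_of_support_subset hχΩ, eLpNorm_restrict_eq_of_support_subset hχΩ,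
      ← eLpNorm_restrict_eq_of_support_subset hχW, ← eLpNorm_restrict_eq_of_support_subset
        (p := 2) hχW, mul_comm]
    refine (eLpNorm_one_le_eLpNorm_two_mul χ.continuous.aestronglyMeasurable).trans ?_
    gcongr
    calc volume (W : Set (Euc d)) ^ (1 / 2 : ℝ) ≤ (ε ^ (2 : ℝ)) ^ (1 / 2 : ℝ) := by
          gcongr
          exact (measure_mono inter_subset_left).trans hUε.le
      _ = ε := by rw [← ENNReal.rpow_mul]; norm_num

theorem exists_lower_bound_large (hd : 1 ≤ d) (hΩ_nonempty : (Ω : Set (Euc d)).Nonempty)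
    (hΩ : Bornology.IsBounded (Ω : Set (Euc d))) (hK : Continuous K) (hc : HasCompactSupport K)
    (s : ℝ) {R : ℝ} (hR : 0 < R) {β₁ : ℝ} (hβ₁ : 0 < β₁) :
    ∃ c : ℝ, 0 < c ∧ ∀ β : ℝ, β₁ ≤ β → ENNReal.ofReal c ≤ worstError Ω K s R β := by
  obtain ⟨M, hM⟩ := hc.exists_bound_of_continuous hK
  set B := ENNReal.ofReal ((β₁ ^ d)⁻¹ * M) * volume (Ω : Set (Euc d)) ^ (1 / 2 : ℝ) with hB
  have hBtop : B ≠ ⊤ := ENNReal.mul_ne_top ENNReal.ofReal_ne_top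
    (ENNReal.rpow_ne_top_of_nonneg (by norm_num) hΩ.measure_lt_top.ne)
  -- `B` bounds the convolution from L¹ to L² for every `β ≥ β₁`. With the ratio `2⁻¹ / B`, the
  -- image of `φ` has at most half the L² norm of `φ`, so the error has at least the other half.
  obtain ⟨φ, hφ0, hφ1⟩ := exists_testFunction_eLpNorm_one_le hd hΩ_nonempty
    (ENNReal.div_pos (a := 2⁻¹) (by simp) hBtop)
  obtain ⟨c, hc0, hcle⟩ := exists_const_mul_eLpNorm_le_worstError hd hΩ K s hR φ
  have hφ2 : MemLp φ 2 (volume.restrict (Ω : Set (Euc d))) :=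
    (memLp_of_contDiff φ.contDiff φ.hasCompactSupport).restrict _
  set a := eLpNorm φ 2 (volume.restrict (Ω : Set (Euc d))) with ha
  have hatop : a ≠ ⊤ := hφ2.eLpNorm_lt_top.ne
  have hat := ENNReal.toReal_pos hφ0.ne' hatop
  refine ⟨c * (a / 2).toReal, ?_, fun β hβ => le_trans ?_ (hcle β)⟩
  · rw [ENNReal.toReal_div, ENNReal.toReal_ofNat]
    positivity
  rw [ENNReal.ofReal_mul hc0.le, ENNReal.ofReal_toReal (ENNReal.div_ne_top hatop (by simp))]
  gcongr
  have hβ0 : 0 < β := hβ₁.trans_le hβ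
  have hM0 : 0 ≤ M := (norm_nonneg _).trans (hM 0)
  have hreg : eLpNorm (regularise Ω K β φ) 2 (volume.restrict (Ω : Set (Euc d))) ≤ a / 2 := by
    calc _ ≤ B * (2⁻¹ / B * a) := by
          refine (eLpNorm_regularise_le hM hβ0 _).trans ?_
          rw [hB]
          gcongr
      _ = B * (2⁻¹ / B) * a := (mul_assoc _ _ _).symm
      _ ≤ 2⁻¹ * a := by gcongr; exact ENNReal.mul_div_le
      _ = a / 2 := by rw [div_eq_mul_inv, mul_comm]
  have m1 := aestronglyMeasurable_regularise (Ω := Ω) hK β hφ2.1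
  have htri : a ≤ a / 2 +
      eLpNorm (fun x => regularise Ω K β φ x - φ x) 2 (volume.restrict (Ω : Set (Euc d))) := by
    calc a = eLpNorm (regularise Ω K β φ - fun x => regularise Ω K β φ x - φ x) 2
          (volume.restrict (Ω : Set (Euc d))) := by
          rw [ha]; congr 1; ext x; simp
      _ ≤ _ := (eLpNorm_sub_le m1 (m1.sub hφ2.1) (by norm_num)).trans
          (add_le_add hreg le_rfl)
  refine (ENNReal.add_le_add_iff_left (ENNReal.div_ne_top hatop (by simp : (2 : ℝ≥0∞) ≠ 0))).1 ?_
  rwa [ENNReal.add_halves]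

end LowerBound

end SobolevReg

/-! ### Assembly of the two bounds -/

theorem mainTheorem6 (d : ℕ) (hd : 1 ≤ d)
    (Ω : Opens (SobolevReg.Euc d)) (hΩ_nonempty : (Ω : Set (SobolevReg.Euc d)).Nonempty)
    (hΩ_bounded : Bornology.IsBounded (Ω : Set (SobolevReg.Euc d)))
    (K : SobolevReg.Euc d → ℝ) (hK_smooth : ContDiff ℝ ∞ K) (hK_supp : HasCompactSupport K)
    (hK_int : ∫ x, K x = 1)
    (sr : ℕ) (hsr : 1 ≤ sr)
    (hK_vanish : ∀ r : Fin d → ℕ, 1 ≤ ∑ i, r i → ∑ i, r i ≤ sr - 1 → SobolevReg.moment K r = 0)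
    (hK_nonvanish : ∃ r : Fin d → ℕ, ∑ i, r i = sr ∧ SobolevReg.moment K r ≠ 0)
    (s : ℝ) (hs : (sr : ℝ) ≤ s) (R : ℝ) (hR : 0 < R) :
    (∃ C : ℝ, 0 < C ∧ ∀ β : ℝ, 0 < β →
      SobolevReg.worstError Ω K s R β ≤ ENNReal.ofReal (C * β ^ sr)) ∧
    (∀ β₀ : ℝ, 0 < β₀ → ∃ c : ℝ, 0 < c ∧ ∀ β : ℝ, 0 < β → β ≤ β₀ →
      ENNReal.ofReal (c * β ^ sr) ≤ SobolevReg.worstError Ω K s R β) := by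
  obtain ⟨n, rfl⟩ : ∃ n, sr = n + 1 := ⟨sr - 1, by omega⟩
  rw [Nat.add_sub_cancel] at hK_vanish
  have hK := hK_smooth.continuous
  constructor
  · set A := SobolevReg.absMoment K (n + 1) *
      (Fintype.card (Fin (n + 1) → Fin d) * ENNReal.ofReal R) with hA
    have hAtop : A ≠ ⊤ := ENNReal.mul_ne_top (SobolevReg.absMoment_lt_top hK hK_supp _).ne
      (ENNReal.mul_ne_top (ENNReal.natCast_ne_top _) ENNReal.ofReal_ne_top)
    -- `A` may be zero as far as is known here; adding 1 makes the constant positive.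
    refine ⟨A.toReal + 1, by positivity, fun β hβ => iSup₂_le fun f hf => ?_⟩
    refine (SobolevReg.eLpNorm_regularise_sub_le_of_mem_sobolevBall hΩ_bounded hK hK_supp hK_int
      hK_vanish (Nat.le_floor hs) hβ hf).trans ?_
    rw [mul_assoc, ← hA, mul_comm, ENNReal.ofReal_mul (by positivity)]
    gcongr
    exact (ENNReal.ofReal_toReal hAtop).ge.trans (ENNReal.ofReal_le_ofReal (by linarith))
  · intro β₀ hβ₀
    obtain ⟨β₁, hβ₁, c₁, hc₁, h₁⟩ := SobolevReg.exists_lower_bound_small hd hΩ_nonempty hΩ_bounded hK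
      hK_supp hK_int hK_vanish hK_nonvanish s hR
    obtain ⟨c₂, hc₂, h₂⟩ := SobolevReg.exists_lower_bound_large hd hΩ_nonempty hΩ_bounded hK hK_supp
      s hR hβ₁
    -- Above the threshold `β₁` the lower bound is the constant `c₂`; dividing by `β₀ ^ (n + 1)`
    -- turns it into a multiple of `β ^ (n + 1)`, since `β ≤ β₀`.
    refine ⟨min c₁ (c₂ / β₀ ^ (n + 1)), by positivity, fun β hβ hββ₀ => ?_⟩
    rcases le_total β β₁ with h | h
    · refine le_trans (ENNReal.ofReal_le_ofReal ?_) (h₁ β hβ h)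
      gcongr
      exact min_le_left _ _
    · refine le_trans (ENNReal.ofReal_le_ofReal ?_) (h₂ β h)
      calc min c₁ (c₂ / β₀ ^ (n + 1)) * β ^ (n + 1)
          ≤ c₂ / β₀ ^ (n + 1) * β₀ ^ (n + 1) := by
            gcongr
            exact min_le_right _ _
        _ = c₂ := by field_simp
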